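/- Let $X=\{X_0,X_1,X_2\}$ be three non-commuting indeterminates and let $\mathrm{Br}(X)$ be the free magma over $X$, i.e. the set of formal iterated brackets $(a,b)$ of elements of $X$. Let $\mathcal L(X)$ be the free Lie algebra over $\mathbb R$ generated by $X$, i.e. the smallest linear subspace of the free associative algebra $\mathbb R\langle X_0,X_1,X_2\rangle$ that contains $X$ and is stable under $[a,b]=ab-ba$. Let $\mathrm e:\mathrm{Br}(X)\to\mathcal L(X)$ be the evaluation, $\mathrm e(X_i)=X_i$, $\mathrm e((a,b))=[\mathrm e(a),\mathrm e(b)]$. For $b\in\mathrm{Br}(X)$ let $n(b)$ be the total number of occurrences of $X_1$ and $X_2$ in $b$, and let $S_2(X)=\mathrm{Span}_{\mathbb R}\{\mathrm e(b):\ b\in\mathrm{Br}(X),\ n(b)=2\}\subset\mathcal L(X)$. If $b=(b_1,b_2)\in\mathrm{Br}(X)\setminus X$, write $\lambda(b)=b_1$. A Hall set is a subset $\mathcal B\subset\mathrm{Br}(X)$ endowed with a total order $<$ such that (i) $X\subset\mathcal B$; (ii) for all $b_1,b_2\in\mathrm{Br}(X)$, $(b_1,b_2)\in\mathcal B$ if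 and only if $b_1,b_2\in\mathcal B$, $b_1<b_2$ and either $b_2\in X$ or $\lambda(b_2)\le b_1$; (iii) for all $b_1,b_2\in\mathcal B$ with $(b_1,b_2)\in\mathcal B$, $b_1<(b_1,b_2)$. Put $\mathcal B_k=\{b\in\mathcal B:\ n(b)=k\}$. For $\nu\in\mathbb N=\{0,1,2,\dots\}$ write $b0^\nu=(\cdots(b,X_0),\dots,X_0)$ for $b\in\mathrm{Br}(X)$, and $b0^\nu=[\cdots[b,X_0],\dots,X_0]$ for $b\in\mathcal L(X)$, with $X_0$ appearing $\nu$ times. For $b=(b_1,b_2)\in\mathrm{Br}(X)$, let $(-1)^jb$ denote $(b_2,b_1)$ if $j$ is odd and $b$ if $j$ is even. 1. There exists a Hall set $\mathcal B$ in which $X_0$ is maximal and such that $$\mathcal B_1=\{M^i_j:=X_i0^j:\ i\in\{1,2\},\ j\in\mathbb N\},$$ $$\mathcal B_2=\Big\{C_{j,l}:=\Big((-1)^j\big(M^1_{\lfloor (j+1)/2\rfloor},M^2_{\lfloor j/2\rfloor}\big)\Big)0^l:\ j,l\in\mathbb N\Big\}\cup\Big\{W^i_{j,l}:=(M^i_{j-1},M^i_j)0^l:\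 i\in\{1,2\},\ j\in\mathbb N,\ j\ge1,\ l\in\mathbb N\Big\}.$$ 2. For all admissible indices, the evaluations in $\mathcal L(X)$ of these formal brackets are $$\mathrm e(W^i_{j,l})=[X_i0^{j-1},X_i0^j]0^l,\qquad \mathrm e(C_{j,l})=(-1)^j[X_10^{\lfloor (j+1)/2\rfloor},X_20^{\lfloor j/2\rfloor}]0^l,$$ where $(-1)^j$ is now the usual sign, and the family $$\big([X_i0^{j-1},X_i0^j]0^l\big)_{i\in\{1,2\},\,j\ge1,\,l\ge0}\ \cup\ \big((-1)^j[X_10^{\lfloor (j+1)/2\rfloor},X_20^{\lfloor j/2\rfloor}]0^l\big)_{j,l\ge0}$$ is a basis of the real vector space $S_2(X)$. -/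

import Mathlib

attribute [local instance] LieRing.ofAssociativeRing

noncomputable section

namespace HallLayers

/-- Formal iterated brackets `Br(X)`: the free magma over `X = {X₀, X₁, X₂}`.
The ordered pair `(a, b)` is `a * b`. -/
abbrev Br : Type := FreeMagma (Fin 3)

/-- The indeterminate `X_i` as a formal bracket. -/
def X (i : Fin 3) : Br := FreeMagma.of i

/-- The free Lie algebra `𝓛(X)` over `ℝ`: the smallest linear subspace of the free associative
algebra `𝓐(X)` that contains the indeterminates and is stable under `[a, b] = ab - ba`. -/
def freeLie : LieSubalgebra ℝ (FreeAlgebra ℝ (Fin 3)) :=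
  LieSubalgebra.lieSpan ℝ (FreeAlgebra ℝ (Fin 3)) (Set.range (FreeAlgebra.ι ℝ))

/-- The indeterminate `X_i` as an element of `𝓛(X)`. -/
def xL (i : Fin 3) : freeLie :=
  ⟨FreeAlgebra.ι ℝ i, LieSubalgebra.subset_lieSpan (Set.mem_range_self i)⟩

/-- The evaluation `e : Br(X) → 𝓛(X)`. -/
def ev : Br → freeLie
  | .of i => xL i
  | .mul a b => ⁅ev a, ev b⁆

/-- The number `n_k(b)` of occurrences of `X_k` in `b`. -/
def occ (k : Fin 3) : Br → ℕ
  | .of i => if i = k then 1 else 0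
  | .mul a b => occ k a + occ k b

/-- `n(b) = n₁(b) + n₂(b)`. -/
def nn (b : Br) : ℕ := occ 1 b + occ 2 b

/-- `S_A(X) = Span {e(b) ; b ∈ Br(X), n(b) ∈ A}`. -/
def S (A : Set ℕ) : Submodule ℝ freeLie :=
  Submodule.span ℝ (ev '' {b : Br | nn b ∈ A})

/-- A Hall set: a subset `B` of `Br(X)` endowed with a total order. In `mul_mem_iff`, the element
`c` of the decomposition `b₂ = (c, d)` is the left factor `λ(b₂)`. -/
structure IsHallSet (B : Set Br) [LinearOrder B] : Prop where
  gen_mem : ∀ i, X i ∈ B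
  mul_mem_iff : ∀ b₁ b₂ : Br, b₁ * b₂ ∈ B ↔
    ∃ (h₁ : b₁ ∈ B) (h₂ : b₂ ∈ B), (⟨b₁, h₁⟩ : B) < ⟨b₂, h₂⟩ ∧
      ((∃ i, b₂ = X i) ∨
        ∃ (c d : Br) (hc : c ∈ B), b₂ = c * d ∧ (⟨c, hc⟩ : B) ≤ ⟨b₁, h₁⟩)
  lt_mul : ∀ (b₁ b₂ : B) (h : (b₁ : Br) * (b₂ : Br) ∈ B), b₁ < ⟨(b₁ : Br) * (b₂ : Br), h⟩

/-- `B_A = {b ∈ B ; n(b) ∈ A}`. -/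
def layer (B : Set Br) (A : Set ℕ) : Set Br := {b | b ∈ B ∧ nn b ∈ A}

/-- `b 0^ν = (⋯(b, X₀), …, X₀)` in `Br(X)`. -/
def brZero (b : Br) : ℕ → Br
  | 0 => b
  | ν + 1 => brZero b ν * X 0

/-- `a 0^ν = [⋯[a, X₀], …, X₀]` in `𝓛(X)`. -/
def lieZero (a : freeLie) : ℕ → freeLie
  | 0 => a
  | ν + 1 => ⁅lieZero a ν, xL 0⁆

/-- `(-1)^j (a, b)` in `Br(X)`: the pair `(b, a)` if `j` is odd, `(a, b)` if `j` is even. -/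
def signedPair (j : ℕ) (a b : Br) : Br := if Odd j then b * a else a * b

/-- `M^i_j = X_i 0^j`. -/
def brM (i : Fin 3) (j : ℕ) : Br := brZero (X i) j

/-- `W^i_{j,l} = (M^i_{j-1}, M^i_j) 0^l` in `Br(X)`, used for `j ≥ 1` and `i ∈ {1, 2}`. -/
def brW (i : Fin 3) (j l : ℕ) : Br := brZero (brM i (j - 1) * brM i j) l

/-- `C_{j,l} = (-1)^j (M^1_{⌊(j+1)/2⌋}, M^2_{⌊j/2⌋}) 0^l` in `Br(X)`. -/
def brC (j l : ℕ) : Br := brZero (signedPair j (brM 1 ((j + 1) / 2)) (brM 2 (j / 2))) l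

/-- `W^i_{j,l} = [X_i 0^{j-1}, X_i 0^j] 0^l` in `𝓛(X)`, used for `j ≥ 1` and `i ∈ {1, 2}`. -/
def lieW (i : Fin 3) (j l : ℕ) : freeLie :=
  lieZero ⁅lieZero (xL i) (j - 1), lieZero (xL i) j⁆ l

/-- `C_{j,l} = (-1)^j [X₁ 0^{⌊(j+1)/2⌋}, X₂ 0^{⌊j/2⌋}] 0^l` in `𝓛(X)`. -/
def lieC (j l : ℕ) : freeLie :=
  (-1 : ℝ) ^ j • lieZero ⁅lieZero (xL 1) ((j + 1) / 2), lieZero (xL 2) (j / 2)⁆ l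

/-- Indices of the family: `(i, j, l)` with `i ∈ {1, 2}`, `j ≥ 1` and `l ≥ 0` for the `W^i_{j,l}`,
and `(j, l)` with `j, l ≥ 0` for the `C_{j,l}`. -/
abbrev Idx : Type := ({i : Fin 3 // i ≠ 0} × ℕ+ × ℕ) ⊕ (ℕ × ℕ)

/-- The family `(W^i_{j,l}) ∪ (C_{j,l})` of elements of `𝓛(X)`. -/
def family : Idx → freeLie
  | .inl (i, j, l) => lieW i j l
  | .inr (j, l) => lieC j l

end HallLayers

end

noncomputable section

namespace HallLayers

/-! Hall set: order brackets with `X 0` last, then by `nn`, length and number of `X_2`. Since `X 0`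
is maximal it is never a left factor, so `n(b) = 1` forces `b = X_i 0^j`, and these form the chain
`M^1_0 < M^2_0 < M^1_1 < M^2_1 < ⋯`. A pair of them is Hall exactly when `M^{i'}_{j'-1} ≤ M^i_j <
M^{i'}_{j'}` (the left inequality void if `j' = 0`), which leaves only the `C` and `W` with `l = 0`
(`Hall.eq_of_brM_mul_brM`).

Spanning: by Leibniz, an `X_0` moves from one factor of `[X_i 0^j, X_k 0^m]` to the other modulo
`[·, X_0]`, reducing to nearly equal exponents (`lie_add_mem`).

Independence: send `X_0` to `diag(0, p, p+q)` and `X_1, X_2` to strictly upper triangular matrices.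
The corner entry turns `W_{j,l}` into `(p+q)^l (pq)^{j-1} (q-p)`, and `C_{2k,l}`, `C_{2k+1,l}` into
`(p+q)^l (pq)^k` times `1`, `-p`. With `s = p+q`, `t = pq`, everything follows from `1, p` being a
basis over `ℝ[t][s]`, which gives an explicit dual family (`dualForm_family`). -/

lemma nn_mul (a b : Br) : nn (a * b) = nn a + nn b := by
  change (occ 1 a + occ 1 b) + (occ 2 a + occ 2 b) = (occ 1 a + occ 2 a) + (occ 1 b + occ 2 b)
  ring

lemma nn_mul' (a b : Br) : nn (.mul a b) = nn a + nn b := nn_mul a b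

lemma nn_X_zero : nn (X 0) = 0 := rfl

lemma nn_of (i : Fin 3) : nn (.of i) = if i = 0 then 0 else 1 := by
  fin_cases i <;> rfl

lemma nn_X {i : Fin 3} (hi : i ≠ 0) : nn (X i) = 1 := by
  simp [X, nn_of, hi]

lemma nn_brZero (b : Br) (l : ℕ) : nn (brZero b l) = nn b := by
  induction l with
  | zero => rfl
  | succ l ih => rw [brZero, nn_mul, ih, nn_X_zero, add_zero]

lemma nn_brM {i : Fin 3} (hi : i ≠ 0) (j : ℕ) : nn (brM i j) = 1 := by
  rw [brM, nn_brZero, nn_X hi]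

lemma occ_brM (k i : Fin 3) (hk : k ≠ 0) (j : ℕ) : occ k (brM i j) = if i = k then 1 else 0 := by
  induction j with
  | zero => rfl
  | succ j ih =>
    change occ k (brM i j) + (if (0 : Fin 3) = k then 1 else 0) = _
    rw [ih, if_neg hk.symm, add_zero]

lemma length_mul' (a b : Br) : (a * b).length = a.length + b.length := rfl

lemma length_brM (i : Fin 3) (j : ℕ) : (brM i j).length = j + 1 := by
  induction j with
  | zero => rfl
  | succ j ih =>
    change (brM i j).length + 1 = _
    rw [ih]

lemma signedPair_cases (j : ℕ) (a b : Br) : signedPair j a b = a * b ∨ signedPair j a b = b * a := by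
  unfold signedPair; split_ifs <;> simp

lemma nn_brC (j l : ℕ) : nn (brC j l) = 2 := by
  rw [brC, nn_brZero]
  rcases signedPair_cases j (brM 1 ((j + 1) / 2)) (brM 2 (j / 2)) with h | h <;>
    rw [h, nn_mul, nn_brM (by decide), nn_brM (by decide)]

lemma nn_brW {i : Fin 3} (hi : i ≠ 0) (j l : ℕ) : nn (brW i j l) = 2 := by
  rw [brW, nn_brZero, nn_mul, nn_brM hi, nn_brM hi]

/-- A linear order on brackets without further properties, used to break ties. -/
abbrev tieOrder : LinearOrder Br :=
  letI : DecidableRel (WellOrderingRel (α := Br)) := Classical.decRel _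
  linearOrderOfSTO WellOrderingRel

/-- The type of brackets with the tie-breaking order. -/
def TieBr : Type := Br

instance : LinearOrder TieBr := tieOrder

/-- The key by which brackets are compared: `X₀` comes last, then the number of occurrences of
`X₁` and `X₂`, the length, and the number of occurrences of `X₂` are compared. -/
def orderKey (b : Br) : ℕ ×ₗ ℕ ×ₗ ℕ ×ₗ ℕ ×ₗ TieBr :=
  toLex (if b = X 0 then 1 else 0,
    toLex (nn b, toLex (b.length, toLex (occ 2 b, (show TieBr from b)))))

lemma orderKey_injective : Function.Injective orderKey := fun a b h => by
  have h2 := congrArg (fun k => (ofLex (ofLex (ofLex (ofLex k).2).2).2).2) h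
  exact h2

/-- The order on brackets given by `orderKey`. -/
abbrev bracketOrder : LinearOrder Br := LinearOrder.lift' orderKey orderKey_injective

/-! ### The Hall set and its first two layers -/

section HallSet

attribute [local instance] bracketOrder

lemma lt_iff_orderKey (a b : Br) : a < b ↔ orderKey a < orderKey b := Iff.rfl

lemma lt_X_zero {b : Br} (hb : b ≠ X 0) : b < X 0 := by
  rw [lt_iff_orderKey, orderKey, orderKey, Prod.Lex.toLex_lt_toLex]
  left; simp [hb]

lemma le_X_zero (b : Br) : b ≤ X 0 := by
  by_cases hb : b = X 0
  · exact hb.le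
  · exact (lt_X_zero hb).le

lemma ne_X_zero_of_nn_pos {b : Br} (hb : 0 < nn b) : b ≠ X 0 := by
  rintro rfl; simp [nn_X_zero] at hb

lemma mul_ne_X_zero (a b : Br) : a * b ≠ X 0 := by
  intro h; cases h

/-- A right factor cannot lower `nn` and strictly raises the length. The maximal element `X 0` has
to be excluded. -/
lemma lt_mul_self {a : Br} (ha : a ≠ X 0) (b : Br) : a < a * b := by
  rw [lt_iff_orderKey, orderKey, orderKey, Prod.Lex.toLex_lt_toLex, if_neg ha,
    if_neg (mul_ne_X_zero a b)]
  refine Or.inr ⟨rfl, ?_⟩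
  have := b.length_pos
  simp only [Prod.Lex.toLex_lt_toLex, nn_mul, length_mul']
  omega

lemma brM_ne_X_zero {i : Fin 3} (hi : i ≠ 0) (j : ℕ) : brM i j ≠ X 0 :=
  ne_X_zero_of_nn_pos (by rw [nn_brM hi]; exact one_pos)

lemma brM_lt_of {i i' : Fin 3} {j j' : ℕ} (hi : i ≠ 0) (hi' : i' ≠ 0)
    (h : j < j' ∨ j = j' ∧ i < i') : brM i j < brM i' j' := by
  rw [lt_iff_orderKey, orderKey, orderKey, Prod.Lex.toLex_lt_toLex,
    if_neg (brM_ne_X_zero hi j), if_neg (brM_ne_X_zero hi' j')]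
  refine Or.inr ⟨rfl, ?_⟩
  rw [Prod.Lex.toLex_lt_toLex, nn_brM hi, nn_brM hi']
  refine Or.inr ⟨rfl, ?_⟩
  rw [Prod.Lex.toLex_lt_toLex, length_brM, length_brM]
  rcases h with h | ⟨rfl, h⟩
  · exact Or.inl (by simpa using h)
  · refine Or.inr ⟨rfl, Prod.Lex.toLex_lt_toLex.2 (Or.inl ?_)⟩
    have h1 : i = 1 := by omega
    have h2 : i' = 2 := by omega
    subst h1 h2
    change occ 2 (brM 1 j) < occ 2 (brM 2 j)
    rw [occ_brM _ _ (by decide), occ_brM _ _ (by decide)]; decide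

lemma brM_lt_iff {i i' : Fin 3} {j j' : ℕ} (hi : i ≠ 0) (hi' : i' ≠ 0) :
    brM i j < brM i' j' ↔ j < j' ∨ j = j' ∧ i < i' := by
  refine ⟨fun h => ?_, brM_lt_of hi hi'⟩
  by_contra hc
  by_cases he : i = i' ∧ j = j'
  · rw [he.1, he.2] at h; exact lt_irrefl _ h
  · exact lt_asymm h (brM_lt_of hi' hi (by omega))

/-- The Hall set attached to the order on brackets. -/
def Hall : Br → Prop
  | .of _ => True
  | .mul a b => Hall a ∧ Hall b ∧ a < b ∧ ∀ c d, b = c * d → c ≤ a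

lemma hall_mul (a b : Br) :
    Hall (a * b) ↔ Hall a ∧ Hall b ∧ a < b ∧ ∀ c d, b = c * d → c ≤ a := Iff.rfl

lemma hall_X (i : Fin 3) : Hall (X i) := trivial

lemma isHallSet_hall : IsHallSet {b | Hall b} where
  gen_mem := hall_X
  mul_mem_iff a b := by
    rw [Set.mem_ofPred_eq, hall_mul]
    constructor
    · rintro ⟨ha, hb, hlt, hc⟩
      refine ⟨ha, hb, hlt, ?_⟩
      cases b with
      | of i => exact Or.inl ⟨i, rfl⟩
      | mul c d => exact Or.inr ⟨c, d, hb.1, rfl, hc c d rfl⟩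
    · rintro ⟨ha, hb, hlt, ⟨i, rfl⟩ | ⟨c, d, hc, rfl, hle⟩⟩
      · exact ⟨ha, hb, hlt, fun c d h => by cases h⟩
      · refine ⟨ha, hb, hlt, fun c' d' h => ?_⟩
        cases h
        exact hle
  lt_mul a b h := by
    have ha : (a : Br) ≠ X 0 := (lt_of_lt_of_le h.2.2.1 (le_X_zero _)).ne
    exact lt_mul_self ha b

lemma Hall.mul_X_zero {b : Br} (hb : Hall b) (h0 : b ≠ X 0) : Hall (b * X 0) :=
  ⟨hb, hall_X 0, lt_X_zero h0, fun c d h => by cases h⟩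

lemma Hall.brZero {b : Br} (hb : Hall b) (h0 : 0 < nn b) (l : ℕ) : Hall (brZero b l) := by
  induction l with
  | zero => exact hb
  | succ l ih => exact ih.mul_X_zero (ne_X_zero_of_nn_pos (by rwa [nn_brZero]))

lemma hall_brM {i : Fin 3} (hi : i ≠ 0) (j : ℕ) : Hall (brM i j) :=
  (hall_X i).brZero (by rw [nn_X hi]; exact one_pos) j

lemma hall_brM_mul_brM_iff {i i' : Fin 3} {j j' : ℕ} (hi : i ≠ 0) (hi' : i' ≠ 0) :
    Hall (brM i j * brM i' j') ↔ brM i j < brM i' j' ∧ ∀ k, j' = k + 1 → brM i' k ≤ brM i j := by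
  rw [hall_mul]
  refine ⟨fun h => ⟨h.2.2.1, ?_⟩, fun h => ⟨hall_brM hi j, hall_brM hi' j', h.1, ?_⟩⟩
  · rintro k rfl
    exact h.2.2.2 _ _ rfl
  · intro c d hcd
    cases j' with
    | zero => cases hcd
    | succ k =>
      cases hcd
      exact h.2 k rfl

lemma hall_brW {i : Fin 3} (hi : i ≠ 0) {j : ℕ} (hj : 1 ≤ j) (l : ℕ) : Hall (brW i j l) := by
  refine Hall.brZero ?_ (by rw [nn_mul, nn_brM hi, nn_brM hi]; decide) l
  rw [hall_brM_mul_brM_iff hi hi, brM_lt_iff hi hi]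
  refine ⟨by omega, ?_⟩
  rintro k rfl
  exact le_rfl

lemma brC_two_mul (k : ℕ) : brC (2 * k) 0 = brM 1 k * brM 2 k := by
  have h : ¬ Odd (2 * k) := by simp
  rw [brC, signedPair, if_neg h]
  rw [show (2 * k + 1) / 2 = k by omega, show 2 * k / 2 = k by omega]
  rfl

lemma brC_two_mul_add_one (k : ℕ) : brC (2 * k + 1) 0 = brM 2 k * brM 1 (k + 1) := by
  have h : Odd (2 * k + 1) := by simp
  rw [brC, signedPair, if_pos h]
  rw [show (2 * k + 1 + 1) / 2 = k + 1 by omega, show (2 * k + 1) / 2 = k by omega]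
  rfl

lemma hall_brC (j l : ℕ) : Hall (brC j l) := by
  suffices h : Hall (brC j 0) by
    exact h.brZero (by rw [← nn_brZero _ 0]; exact (nn_brC j 0).symm ▸ two_pos) l
  rcases Nat.even_or_odd' j with ⟨k, rfl | rfl⟩
  · rw [brC_two_mul, hall_brM_mul_brM_iff (by decide) (by decide),
      brM_lt_iff (by decide) (by decide)]
    refine ⟨by omega, ?_⟩
    rintro m rfl
    exact (brM_lt_of (by decide) (by decide) (by omega)).le
  · rw [brC_two_mul_add_one, hall_brM_mul_brM_iff (by decide) (by decide),
      brM_lt_iff (by decide) (by decide)]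
    refine ⟨by omega, fun m hm => ?_⟩
    obtain rfl : k = m := by omega
    exact (brM_lt_of (by decide) (by decide) (by omega)).le

lemma Hall.left_ne_X_zero {a b : Br} (h : Hall (a * b)) : a ≠ X 0 :=
  (lt_of_lt_of_le h.2.2.1 (le_X_zero b)).ne

/-- In a product without `X_1` and `X_2` the left factor would inductively be `X 0`, but nothing
exceeds `X 0`. -/
lemma Hall.eq_X_zero {b : Br} (hb : Hall b) (hn : nn b = 0) : b = X 0 := by
  induction b with
  | of i =>
    rw [nn_of] at hn
    by_cases hi : i = 0
    · rw [hi]; rfl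
    · simp [hi] at hn
  | mul a c iha _ =>
    rw [nn_mul'] at hn
    exact absurd (iha hb.1 (by omega)) (Hall.left_ne_X_zero hb)

lemma Hall.nn_left_pos {a b : Br} (h : Hall (a * b)) : 0 < nn a :=
  Nat.pos_of_ne_zero fun h0 => h.left_ne_X_zero (h.1.eq_X_zero h0)

lemma Hall.eq_brM {b : Br} (hb : Hall b) (hn : nn b = 1) : ∃ i j, i ≠ 0 ∧ b = brM i j := by
  induction b with
  | of i =>
    rw [nn_of] at hn
    refine ⟨i, 0, ?_, rfl⟩
    rintro rfl; simp at hn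
  | mul a c iha _ =>
    have hpos := Hall.nn_left_pos hb
    rw [nn_mul'] at hn
    obtain ⟨i, j, hi, rfl⟩ := iha hb.1 (by omega)
    exact ⟨i, j + 1, hi, by rw [hb.2.1.eq_X_zero (by omega)]; rfl⟩

lemma Hall.eq_of_brM_mul_brM {i i' : Fin 3} {j j' : ℕ} (hi : i ≠ 0) (hi' : i' ≠ 0)
    (h : Hall (brM i j * brM i' j')) :
    (∃ m, brM i j * brM i' j' = brC m 0) ∨ (1 ≤ j' ∧ brM i j * brM i' j' = brW i' j' 0) := by
  rw [hall_brM_mul_brM_iff hi hi', brM_lt_iff hi hi'] at h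
  obtain ⟨h1, h2⟩ := h
  simp only [← not_lt, brM_lt_iff hi hi'] at h2
  have h3 : ∀ k, j' = k + 1 → ¬(j < k ∨ j = k ∧ i < i') := h2
  obtain rfl | rfl : i = 1 ∨ i = 2 := by omega
  all_goals obtain rfl | rfl : i' = 1 ∨ i' = 2 := by omega
  · obtain rfl : j' = j + 1 := by
      -- If `j' = 0`, truncated subtraction makes the premise `j' = j' - 1 + 1` false, and `h1`
      -- alone decides; the same holds in the other cases.
      have := h3 (j' - 1)
      omega
    exact Or.inr ⟨by omega, rfl⟩
  · obtain rfl : j' = j := by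
      have := h3 (j' - 1)
      omega
    exact Or.inl ⟨2 * j', (brC_two_mul j').symm⟩
  · obtain rfl : j' = j + 1 := by
      have := h3 (j' - 1)
      omega
    exact Or.inl ⟨2 * j + 1, (brC_two_mul_add_one j).symm⟩
  · obtain rfl : j' = j + 1 := by
      have := h3 (j' - 1)
      omega
    exact Or.inr ⟨by omega, rfl⟩

lemma Hall.eq_brC_or_brW {b : Br} (hb : Hall b) (hn : nn b = 2) :
    (∃ j l, b = brC j l) ∨ ∃ i j l, i ≠ 0 ∧ 1 ≤ j ∧ b = brW i j l := by
  induction b with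
  | of i =>
    rw [nn_of] at hn
    split_ifs at hn
    omega
  | mul a c iha _ =>
    have hpos := Hall.nn_left_pos hb
    rw [nn_mul'] at hn
    obtain h1 | h2 : nn a = 1 ∨ nn a = 2 := by omega
    · obtain ⟨i, j, hi, rfl⟩ := hb.1.eq_brM h1
      obtain ⟨i', j', hi', rfl⟩ := hb.2.1.eq_brM (by omega)
      rcases Hall.eq_of_brM_mul_brM hi hi' hb with ⟨m, hm⟩ | ⟨hj, hw⟩
      · exact Or.inl ⟨m, 0, hm⟩
      · exact Or.inr ⟨i', j', 0, hi', hj, hw⟩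
    · obtain rfl := hb.2.1.eq_X_zero (by omega)
      rcases iha hb.1 h2 with ⟨j, l, rfl⟩ | ⟨i, j, l, hi, hj, rfl⟩
      · exact Or.inl ⟨j, l + 1, rfl⟩
      · exact Or.inr ⟨i, j, l + 1, hi, hj, rfl⟩

/-- The order on the Hall set induced by the order on brackets. -/
abbrev hallOrder : LinearOrder {b | Hall b} := inferInstance

end HallSet

theorem exists_hallSet :
    ∃ (B : Set Br) (_ : LinearOrder B), IsHallSet B ∧
      (∃ h0 : X 0 ∈ B, ∀ b : B, b ≤ ⟨X 0, h0⟩) ∧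
      layer B {1} = {b | ∃ (i : Fin 3) (j : ℕ), i ≠ 0 ∧ b = brM i j} ∧
      layer B {2} = {b | ∃ (j l : ℕ), b = brC j l} ∪
        {b | ∃ (i : Fin 3) (j l : ℕ), i ≠ 0 ∧ 1 ≤ j ∧ b = brW i j l} := by
  refine ⟨{b | Hall b}, hallOrder, isHallSet_hall, ⟨hall_X 0, fun b => le_X_zero b⟩, ?_, ?_⟩
  · ext b
    constructor
    · exact fun h => h.1.eq_brM h.2
    · rintro ⟨i, j, hi, rfl⟩
      exact ⟨hall_brM hi j, nn_brM hi j⟩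
  · ext b
    constructor
    · exact fun h => h.1.eq_brC_or_brW h.2
    · rintro (⟨j, l, rfl⟩ | ⟨i, j, l, hi, hj, rfl⟩)
      · exact ⟨hall_brC j l, nn_brC j l⟩
      · exact ⟨hall_brW hi hj l, nn_brW hi j l⟩


/-! ### Evaluation and the spanning property -/

lemma ev_X (i : Fin 3) : ev (X i) = xL i := rfl

lemma ev_mul (a b : Br) : ev (a * b) = ⁅ev a, ev b⁆ := rfl

lemma ev_mul' (a b : Br) : ev (.mul a b) = ⁅ev a, ev b⁆ := rfl

lemma ev_brZero (b : Br) (l : ℕ) : ev (brZero b l) = lieZero (ev b) l := by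
  induction l with
  | zero => rfl
  | succ l ih => rw [brZero, ev_mul, ih]; rfl

lemma ev_brM (i : Fin 3) (j : ℕ) : ev (brM i j) = lieZero (xL i) j := by
  rw [brM, ev_brZero, ev_X]

lemma lieZero_neg (a : freeLie) (l : ℕ) : lieZero (-a) l = -lieZero a l := by
  induction l with
  | zero => rfl
  | succ l ih => simp only [lieZero, ih, neg_lie]

lemma ev_brW (i : Fin 3) (j l : ℕ) : ev (brW i j l) = lieW i j l := by
  rw [brW, ev_brZero, ev_mul, ev_brM, ev_brM, lieW]

lemma ev_brC (j l : ℕ) : ev (brC j l) = lieC j l := by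
  rw [brC, ev_brZero, lieC, signedPair]
  split_ifs with h
  · rw [ev_mul, ev_brM, ev_brM, ← lie_skew, lieZero_neg, h.neg_one_pow, neg_smul, one_smul]
  · rw [ev_mul, ev_brM, ev_brM, (Nat.not_odd_iff_even.1 h).neg_one_pow, one_smul]

lemma lie_lie_xL_zero (a b : freeLie) :
    ⁅⁅a, xL 0⁆, b⁆ = ⁅⁅a, b⁆, xL 0⁆ - ⁅a, ⁅b, xL 0⁆⁆ := by
  rw [leibniz_lie a b, ← lie_skew ⁅a, xL 0⁆ b]
  abel

/-- The span of the family `(W^i_{j,l}) ∪ (C_{j,l})`. -/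
def familySpan : Submodule ℝ freeLie := Submodule.span ℝ (Set.range family)

lemma lieW_mem {i : Fin 3} (hi : i ≠ 0) {j : ℕ} (hj : 1 ≤ j) (l : ℕ) :
    lieW i j l ∈ familySpan :=
  Submodule.subset_span ⟨.inl (⟨i, hi⟩, ⟨j, hj⟩, l), rfl⟩

lemma lieC_mem (j l : ℕ) : lieC j l ∈ familySpan :=
  Submodule.subset_span ⟨.inr (j, l), rfl⟩

lemma lie_xL_zero_mem {v : freeLie} (hv : v ∈ familySpan) : ⁅v, xL 0⁆ ∈ familySpan := by
  induction hv using Submodule.span_induction with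
  | mem x hx =>
    obtain ⟨⟨⟨i, hi⟩, j, l⟩ | ⟨j, l⟩, rfl⟩ := hx
    · exact lieW_mem hi j.2 (l + 1)
    · have h : lieC j (l + 1) = ⁅family (.inr (j, l)), xL 0⁆ := by
        simp only [family, lieC, lieZero, smul_lie]
      rw [← h]
      exact lieC_mem j (l + 1)
  | zero => rw [zero_lie]; exact zero_mem _
  | add x y _ _ hx hy => rw [add_lie]; exact add_mem hx hy
  | smul c x _ hx => rw [smul_lie]; exact Submodule.smul_mem _ _ hx

lemma lie_lieZero_succ_left (a b : freeLie) (j m : ℕ) :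
    ⁅lieZero a (j + 1), lieZero b m⁆ =
      ⁅⁅lieZero a j, lieZero b m⁆, xL 0⁆ - ⁅lieZero a j, lieZero b (m + 1)⁆ :=
  lie_lie_xL_zero _ _

lemma lie_lieZero_succ_right (a b : freeLie) (j m : ℕ) :
    ⁅lieZero a j, lieZero b (m + 1)⁆ =
      ⁅⁅lieZero a j, lieZero b m⁆, xL 0⁆ - ⁅lieZero a (j + 1), lieZero b m⁆ := by
  rw [lie_lieZero_succ_left]; abel

/-- If the brackets `[a 0^j, b 0^j]` and `[a 0^j, b 0^{j+1}]` belong to the span for all `j`, so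
do all the brackets `[a 0^j, b 0^{j+d}]`. -/
lemma lie_add_mem {a b : freeLie} (h0 : ∀ j, ⁅lieZero a j, lieZero b j⁆ ∈ familySpan)
    (h1 : ∀ j, ⁅lieZero a j, lieZero b (j + 1)⁆ ∈ familySpan) (d j : ℕ) :
    ⁅lieZero a j, lieZero b (j + d)⁆ ∈ familySpan := by
  induction d using Nat.strong_induction_on generalizing j with
  | _ d ih =>
    match d with
    | 0 => exact h0 j
    | 1 => exact h1 j
    | d + 2 =>
      -- Moving one `X_0` to the left factor lowers the gap between exponents by two; the correction
      -- term has gap `d + 1` inside `[·, X_0]`.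
      rw [show j + (d + 2) = (j + (d + 1)) + 1 by ring, lie_lieZero_succ_right]
      refine sub_mem (lie_xL_zero_mem (ih (d + 1) (by omega) j)) ?_
      rw [show j + (d + 1) = (j + 1) + d by ring]
      exact ih d (by omega) (j + 1)

lemma lie_self_mem {i : Fin 3} (hi : i ≠ 0) (j m : ℕ) :
    ⁅lieZero (xL i) j, lieZero (xL i) m⁆ ∈ familySpan := by
  have key : ∀ d j, ⁅lieZero (xL i) j, lieZero (xL i) (j + d)⁆ ∈ familySpan :=
    lie_add_mem (fun j => by rw [lie_self]; exact zero_mem _)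
      (fun j => lieW_mem hi (j := j + 1) (by omega) 0)
  rcases le_total j m with h | h
  · obtain ⟨d, rfl⟩ := Nat.exists_eq_add_of_le h
    exact key d j
  · obtain ⟨d, rfl⟩ := Nat.exists_eq_add_of_le h
    rw [← lie_skew]
    exact neg_mem (key d m)

lemma lie_one_two_mem (j m : ℕ) : ⁅lieZero (xL 1) j, lieZero (xL 2) m⁆ ∈ familySpan := by
  have hC : ∀ n, ⁅lieZero (xL 1) ((n + 1) / 2), lieZero (xL 2) (n / 2)⁆ ∈ familySpan := by
    intro n
    rw [← Submodule.smul_mem_iff (x := ⁅lieZero (xL 1) ((n + 1) / 2), lieZero (xL 2) (n / 2)⁆)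
      familySpan (pow_ne_zero n (neg_ne_zero.2 (one_ne_zero (α := ℝ))))]
    exact lieC_mem n 0
  have h0 : ∀ j, ⁅lieZero (xL 1) j, lieZero (xL 2) j⁆ ∈ familySpan := fun j => by
    have := hC (2 * j)
    rwa [show (2 * j + 1) / 2 = j by omega, show 2 * j / 2 = j by omega] at this
  have h1 : ∀ j, ⁅lieZero (xL 1) (j + 1), lieZero (xL 2) j⁆ ∈ familySpan := fun j => by
    have := hC (2 * j + 1)
    rwa [show (2 * j + 1 + 1) / 2 = j + 1 by omega, show (2 * j + 1) / 2 = j by omega] at this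
  rcases le_total j m with h | h
  · obtain ⟨d, rfl⟩ := Nat.exists_eq_add_of_le h
    refine lie_add_mem h0 (fun j => ?_) d j
    -- The `C` only provide exponent differences `0` and `1` in favour of `X_1`; a surplus on `X_2`
    -- is recovered by Leibniz.
    rw [lie_lieZero_succ_right]
    exact sub_mem (lie_xL_zero_mem (h0 j)) (h1 j)
  · obtain ⟨d, rfl⟩ := Nat.exists_eq_add_of_le h
    rw [← lie_skew]
    refine neg_mem (lie_add_mem (fun j => ?_) (fun j => ?_) d m)
    · rw [← lie_skew]; exact neg_mem (h0 j)
    · rw [← lie_skew]; exact neg_mem (h1 j)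

lemma lie_mem {i k : Fin 3} (hi : i ≠ 0) (hk : k ≠ 0) (j m : ℕ) :
    ⁅lieZero (xL i) j, lieZero (xL k) m⁆ ∈ familySpan := by
  by_cases h : i = k
  · subst h; exact lie_self_mem hi j m
  · obtain ⟨rfl, rfl⟩ | ⟨rfl, rfl⟩ : (i = 1 ∧ k = 2) ∨ (i = 2 ∧ k = 1) := by omega
    · exact lie_one_two_mem j m
    · rw [← lie_skew]; exact neg_mem (lie_one_two_mem m j)

lemma ev_eq_smul_of_nn_eq_zero {b : Br} (hb : nn b = 0) : ∃ c : ℝ, ev b = c • xL 0 := by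
  induction b with
  | of i =>
    rw [nn_of] at hb
    obtain rfl : i = 0 := by by_contra hi; simp [hi] at hb
    exact ⟨1, (one_smul _ _).symm⟩
  | mul a c iha ihc =>
    rw [nn_mul'] at hb
    obtain ⟨r, hr⟩ := iha (by omega)
    obtain ⟨s, hs⟩ := ihc (by omega)
    refine ⟨0, ?_⟩
    rw [ev_mul', hr, hs, smul_lie, lie_smul, lie_self, smul_zero, smul_zero,
      zero_smul]

/-- The span of the `X_i 0^j` with `i ∈ {1, 2}`. -/
def spanM : Submodule ℝ freeLie :=
  Submodule.span ℝ {x | ∃ i j, i ≠ 0 ∧ x = lieZero (xL i) j}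

lemma lie_xL_zero_mem_spanM {v : freeLie} (hv : v ∈ spanM) : ⁅v, xL 0⁆ ∈ spanM := by
  induction hv using Submodule.span_induction with
  | mem x hx =>
    obtain ⟨i, j, hi, rfl⟩ := hx
    exact Submodule.subset_span ⟨i, j + 1, hi, rfl⟩
  | zero => rw [zero_lie]; exact zero_mem _
  | add x y _ _ hx hy => rw [add_lie]; exact add_mem hx hy
  | smul c x _ hx => rw [smul_lie]; exact Submodule.smul_mem _ _ hx

lemma lie_mem_familySpan {u v : freeLie} (hu : u ∈ spanM) (hv : v ∈ spanM) :
    ⁅u, v⁆ ∈ familySpan := by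
  induction hu, hv using Submodule.span_induction₂ with
  | mem_mem x y hx hy =>
    obtain ⟨i, j, hi, rfl⟩ := hx
    obtain ⟨k, m, hk, rfl⟩ := hy
    exact lie_mem hi hk j m
  | zero_left y _ => rw [zero_lie]; exact zero_mem _
  | zero_right x _ => rw [lie_zero]; exact zero_mem _
  | add_left x y z _ _ _ hx hy => rw [add_lie]; exact add_mem hx hy
  | add_right x y z _ _ _ hx hy => rw [lie_add]; exact add_mem hx hy
  | smul_left r x y _ _ h => rw [smul_lie]; exact Submodule.smul_mem _ _ h
  | smul_right r x y _ _ h => rw [lie_smul]; exact Submodule.smul_mem _ _ h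

/-- A subspace stable under `[·, X₀]` contains the brackets of its elements with the evaluations
of formal brackets in `X₀` only. -/
lemma lie_ev_mem {V : Submodule ℝ freeLie} (hV : ∀ v ∈ V, ⁅v, xL 0⁆ ∈ V) {v : freeLie} (hv : v ∈ V)
    {c : Br} (hc : nn c = 0) : ⁅v, ev c⁆ ∈ V := by
  obtain ⟨r, hr⟩ := ev_eq_smul_of_nn_eq_zero hc
  rw [hr, lie_smul]
  exact Submodule.smul_mem _ _ (hV v hv)

lemma ev_mem_spanM {b : Br} (hb : nn b = 1) : ev b ∈ spanM := by
  induction b with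
  | of i =>
    rw [nn_of] at hb
    refine Submodule.subset_span ⟨i, 0, ?_, rfl⟩
    rintro rfl; simp at hb
  | mul a c iha ihc =>
    rw [nn_mul'] at hb
    rw [ev_mul']
    obtain ⟨ha, hc⟩ | ⟨ha, hc⟩ : (nn a = 1 ∧ nn c = 0) ∨ (nn a = 0 ∧ nn c = 1) := by omega
    · exact lie_ev_mem (fun _ => lie_xL_zero_mem_spanM) (iha ha) hc
    · rw [← lie_skew]
      exact neg_mem (lie_ev_mem (fun _ => lie_xL_zero_mem_spanM) (ihc hc) ha)

lemma ev_mem_familySpan {b : Br} (hb : nn b = 2) : ev b ∈ familySpan := by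
  induction b with
  | of i =>
    rw [nn_of] at hb
    split_ifs at hb
    omega
  | mul a c iha ihc =>
    rw [nn_mul'] at hb
    rw [ev_mul']
    obtain ⟨ha, hc⟩ | ⟨ha, hc⟩ | ⟨ha, hc⟩ :
      (nn a = 2 ∧ nn c = 0) ∨ (nn a = 1 ∧ nn c = 1) ∨ (nn a = 0 ∧ nn c = 2) := by omega
    · exact lie_ev_mem (fun _ => lie_xL_zero_mem) (iha ha) hc
    · exact lie_mem_familySpan (ev_mem_spanM ha) (ev_mem_spanM hc)
    · rw [← lie_skew]
      exact neg_mem (lie_ev_mem (fun _ => lie_xL_zero_mem) (ihc hc) ha)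

lemma span_range_family : Submodule.span ℝ (Set.range family) = S {2} := by
  refine le_antisymm (Submodule.span_le.2 ?_) (Submodule.span_le.2 ?_)
  · rintro _ ⟨⟨⟨i, hi⟩, j, l⟩ | ⟨j, l⟩, rfl⟩
    · exact Submodule.subset_span ⟨brW i j l, nn_brW hi j l, ev_brW i j l⟩
    · exact Submodule.subset_span ⟨brC j l, nn_brC j l, ev_brC j l⟩
  · rintro _ ⟨b, hb, rfl⟩
    exact ev_mem_familySpan hb


/-! ### Triangular representations and their corner entries -/

open Matrix Polynomial

section Representation

variable {A : Type*} [CommRing A] [Algebra ℝ A]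

/-- The strictly upper triangular `3 × 3` matrix with entries `a`, `b` above the diagonal and `c`
in the corner. -/
def upper (a b c : A) : Matrix (Fin 3) (Fin 3) A := !![0, a, c; 0, 0, b; 0, 0, 0]

/-- The representation of the free algebra in which `X₀` is diagonal and `X_i` has entries
`δ_{iα}` and `δ_{iβ}` above the diagonal. -/
def rep (p q : A) (α β : Fin 3) : FreeAlgebra ℝ (Fin 3) →ₐ[ℝ] Matrix (Fin 3) (Fin 3) A :=
  FreeAlgebra.lift ℝ fun i =>
    if i = 0 then !![0, 0, 0; 0, p, 0; 0, 0, p + q]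
    else upper (if i = α then 1 else 0) (if i = β then 1 else 0) 0

variable {p q : A} {α β : Fin 3}

lemma rep_xL {i : Fin 3} (hi : i ≠ 0) :
    rep p q α β (xL i : FreeAlgebra ℝ (Fin 3)) =
      upper (if i = α then 1 else 0) (if i = β then 1 else 0) 0 := by
  simp [rep, xL, hi]

/-- Products of two strictly upper triangular `3 × 3` matrices live in the corner. -/
lemma rep_lie {u v : freeLie} {a b c a' b' c' : A}
    (hu : rep p q α β (u : FreeAlgebra ℝ (Fin 3)) = upper a b c)
    (hv : rep p q α β (v : FreeAlgebra ℝ (Fin 3)) = upper a' b' c') :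
    rep p q α β (⁅u, v⁆ : freeLie) = upper 0 0 (a * b' - a' * b) := by
  rw [LieSubalgebra.coe_bracket, LieRing.of_associative_ring_bracket, map_sub, map_mul, map_mul,
    hu, hv]
  ext i j
  fin_cases i <;> fin_cases j <;> simp [upper]

/-- Bracketing with `diag(d)` on the right scales entry `(r, s)` by `d_s - d_r`, here `p`, `q` and
`p + q`. -/
lemma rep_lieZero {u : freeLie} {a b c : A}
    (hu : rep p q α β (u : FreeAlgebra ℝ (Fin 3)) = upper a b c) (l : ℕ) :
    rep p q α β (lieZero u l : freeLie) = upper (p ^ l * a) (q ^ l * b) ((p + q) ^ l * c) := by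
  induction l with
  | zero => simpa [lieZero] using hu
  | succ l ih =>
    have h0 : rep p q α β (xL 0 : FreeAlgebra ℝ (Fin 3)) = !![0, 0, 0; 0, p, 0; 0, 0, p + q] := by
      simp [rep, xL]
    rw [lieZero, LieSubalgebra.coe_bracket, LieRing.of_associative_ring_bracket, map_sub, map_mul,
      map_mul, ih, h0]
    ext i j
    fin_cases i <;> fin_cases j <;> simp [upper] <;> ring

/-- The corner entry of the representation, as a linear map on the free Lie algebra. -/
def corner (p q : A) (α β : Fin 3) : freeLie →ₗ[ℝ] A :=
  (Matrix.entryLinearMap ℝ A 0 2) ∘ₗ (rep p q α β).toLinearMap ∘ₗ freeLie.toSubmodule.subtype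

lemma corner_lieZero_lie {i k : Fin 3} (hi : i ≠ 0) (hk : k ≠ 0) (j m l : ℕ) :
    corner p q α β (lieZero ⁅lieZero (xL i) j, lieZero (xL k) m⁆ l) =
      (p + q) ^ l * ((if i = α ∧ k = β then p ^ j * q ^ m else 0) -
        if k = α ∧ i = β then p ^ m * q ^ j else 0) := by
  have h := rep_lieZero (rep_lie (rep_lieZero (rep_xL (p := p) (q := q) (α := α) (β := β) hi) j)
    (rep_lieZero (rep_xL hk) m)) l
  have h2 : corner p q α β (lieZero ⁅lieZero (xL i) j, lieZero (xL k) m⁆ l) =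
      rep p q α β (lieZero ⁅lieZero (xL i) j, lieZero (xL k) m⁆ l : freeLie) 0 2 := rfl
  rw [h2, h]
  simp only [upper, Matrix.of_apply, Matrix.cons_val]
  congr 2
  · rw [ite_and]; split_ifs <;> simp
  · rw [ite_and]; split_ifs <;> simp

lemma corner_lieW {i : Fin 3} (hi : i ≠ 0) (j l : ℕ) :
    corner p q α β (lieW i (j + 1) l) =
      if i = α ∧ i = β then (p + q) ^ l * (p * q) ^ j * (q - p) else 0 := by
  rw [lieW, corner_lieZero_lie hi hi]
  split_ifs
  · rw [Nat.add_sub_cancel]; ring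
  · ring

lemma corner_lieC_self (j l : ℕ) (α : Fin 3) : corner p q α α (lieC j l) = 0 := by
  rw [lieC, map_smul, corner_lieZero_lie (by decide) (by decide), if_neg (by omega),
    if_neg (by omega), sub_zero, mul_zero, smul_zero]

lemma corner_lieC_two_mul (k l : ℕ) :
    corner p q 1 2 (lieC (2 * k) l) = (p + q) ^ l * (p * q) ^ k := by
  rw [lieC, map_smul, corner_lieZero_lie (by decide) (by decide), if_pos (by decide),
    if_neg (by decide), show (2 * k + 1) / 2 = k by omega, show 2 * k / 2 = k by omega]
  simp [mul_pow]

lemma corner_lieC_two_mul_add_one (k l : ℕ) :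
    corner p q 1 2 (lieC (2 * k + 1) l) = -((p + q) ^ l * (p * q) ^ k * p) := by
  rw [lieC, map_smul, corner_lieZero_lie (by decide) (by decide), if_pos (by decide),
    if_neg (by decide), show (2 * k + 1 + 1) / 2 = k + 1 by omega,
    show (2 * k + 1) / 2 = k by omega]
  simp [pow_succ, mul_pow]
  ring

end Representation

/-! ### Dual linear forms and the basis -/

/-- The polynomials in the roots of `ω² - s ω + t` over `ℝ[t][s]`, with basis `1, ω`. -/
abbrev Quad : Type := QuadraticAlgebra ℝ[X][X] (-(C Polynomial.X : ℝ[X][X])) Polynomial.X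

/-- The first root of `ω² - s ω + t`. -/
def root₁ : Quad := ⟨0, 1⟩

/-- The second root of `ω² - s ω + t`. -/
def root₂ : Quad := ⟨Polynomial.X, -1⟩

lemma root_add : root₁ + root₂ = algebraMap ℝ[X][X] Quad Polynomial.X := by
  ext1 <;> simp [root₁, root₂]

lemma root_mul : root₁ * root₂ = algebraMap ℝ[X][X] Quad (C Polynomial.X) := by
  ext1 <;> simp [root₁, root₂] <;> ring

lemma root_add_pow_mul (l k : ℕ) : (root₁ + root₂) ^ l * (root₁ * root₂) ^ k =
    algebraMap ℝ[X][X] Quad (Polynomial.X ^ l * C (Polynomial.X ^ k)) := by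
  rw [root_add, root_mul, ← map_pow, ← map_pow, ← map_mul, C_pow]

/-- The coefficient of `t ^ k * s ^ l`. -/
def coeffTS (k l : ℕ) : ℝ[X][X] →ₗ[ℝ] ℝ where
  toFun f := (f.coeff l).coeff k
  map_add' := by simp
  map_smul' := by simp

lemma coeffTS_monomial (k l k' l' : ℕ) :
    coeffTS k l (Polynomial.X ^ l' * C (Polynomial.X ^ k')) =
      if k = k' ∧ l = l' then 1 else 0 := by
  change ((Polynomial.X ^ l' * C (Polynomial.X ^ k') : ℝ[X][X]).coeff l).coeff k = _
  rw [coeff_mul_C, coeff_X_pow]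
  by_cases h : l = l' <;> simp [h, coeff_X_pow]

/-- The component on `1` in the basis `1, ω`. -/
def quadRe : Quad →ₗ[ℝ] ℝ[X][X] := (QuadraticAlgebra.reₗ _ _).restrictScalars ℝ

/-- The component on `ω` in the basis `1, ω`. -/
def quadIm : Quad →ₗ[ℝ] ℝ[X][X] := (QuadraticAlgebra.imₗ _ _).restrictScalars ℝ

/-- Linear forms dual to the family. -/
def dualForm : Idx → Module.Dual ℝ freeLie
  | .inl (i, j, l) =>
    -- The factor undoes the `ω`-component `-2` of `root₂ - root₁ = s - 2ω`; `j - 1` is the exponent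
    -- of `pq` in the corner entry.
    (-1 / 2 : ℝ) • (coeffTS (j - 1) l ∘ₗ quadIm ∘ₗ corner root₁ root₂ i i)
  | .inr (j, l) =>
    -- Corner entries are `f` for even index and `-f ω` for odd index, with `f = s^l t^{⌊j/2⌋}`;
    -- hence the two components and the sign.
    if Odd j then -(coeffTS (j / 2) l ∘ₗ quadIm ∘ₗ corner root₁ root₂ 1 2)
    else coeffTS (j / 2) l ∘ₗ quadRe ∘ₗ corner root₁ root₂ 1 2

lemma quadIm_mul_sub (f : ℝ[X][X]) :
    quadIm (algebraMap ℝ[X][X] Quad f * (root₂ - root₁)) = (-2 : ℝ) • f := by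
  change (algebraMap ℝ[X][X] Quad f * (root₂ - root₁)).im = _
  rw [neg_smul, two_smul]
  simp [root₁, root₂]
  ring

lemma quadIm_mul_root (f : ℝ[X][X]) : quadIm (algebraMap ℝ[X][X] Quad f * root₁) = f := by
  change (algebraMap ℝ[X][X] Quad f * root₁).im = _
  simp [root₁]

lemma quadRe_mul_root (f : ℝ[X][X]) : quadRe (algebraMap ℝ[X][X] Quad f * root₁) = 0 := by
  change (algebraMap ℝ[X][X] Quad f * root₁).re = _
  simp [root₁]

lemma quadIm_algebraMap (f : ℝ[X][X]) : quadIm (algebraMap ℝ[X][X] Quad f) = 0 := rfl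

lemma quadRe_algebraMap (f : ℝ[X][X]) : quadRe (algebraMap ℝ[X][X] Quad f) = f := rfl

lemma dualForm_family (a b : Idx) : dualForm a (family b) = if a = b then 1 else 0 := by
  rcases a with ⟨⟨i, hi⟩, j, l⟩ | ⟨j, l⟩ <;> rcases b with ⟨⟨i', hi'⟩, j', l'⟩ | ⟨j', l'⟩
  · obtain ⟨m, hm⟩ : ∃ m, (j : ℕ) = m + 1 := Nat.exists_eq_succ_of_ne_zero j.ne_zero
    obtain ⟨m', hm'⟩ : ∃ m, (j' : ℕ) = m + 1 := Nat.exists_eq_succ_of_ne_zero j'.ne_zero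
    have hj : j = j' ↔ m = m' := by rw [← PNat.coe_inj, hm, hm']; omega
    simp only [dualForm, family, LinearMap.smul_apply, LinearMap.comp_apply, hm, hm',
      corner_lieW hi', and_self, Nat.add_sub_cancel, Sum.inl.injEq, Prod.mk.injEq, Subtype.mk.injEq,
      hj]
    by_cases h : i = i'
    · rw [if_pos h.symm, root_add_pow_mul, quadIm_mul_sub, map_smul, coeffTS_monomial, h]
      split_ifs <;> simp_all
    · rw [if_neg (Ne.symm h), if_neg (by tauto), map_zero, map_zero, smul_zero]
  · simp [dualForm, family, corner_lieC_self]
  · obtain ⟨m', hm'⟩ : ∃ m, (j' : ℕ) = m + 1 := Nat.exists_eq_succ_of_ne_zero j'.ne_zero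
    have h : ¬ (i' = 1 ∧ i' = 2) := by omega
    simp only [dualForm, family, hm']
    rw [if_neg (fun e : Sum.inr _ = Sum.inl _ => Sum.inr_ne_inl e)]
    split_ifs <;>
      simp only [LinearMap.neg_apply, LinearMap.comp_apply, corner_lieW hi', if_neg h, map_zero,
        neg_zero]
  · simp only [dualForm, family, Sum.inr.injEq, Prod.mk.injEq]
    rcases Nat.even_or_odd' j' with ⟨k', rfl | rfl⟩ <;>
      by_cases ho : Odd j <;>
      simp only [ho, if_true, if_false, LinearMap.neg_apply,
        LinearMap.comp_apply, corner_lieC_two_mul, corner_lieC_two_mul_add_one, root_add_pow_mul,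
        map_neg, quadIm_algebraMap, quadRe_algebraMap, quadIm_mul_root, quadRe_mul_root, map_zero,
        neg_zero, neg_neg, coeffTS_monomial] <;> rw [Nat.odd_iff] at ho <;>
      split_ifs <;> first | rfl | omega

lemma linearIndependent_family : LinearIndependent ℝ family :=
  LinearIndependent.of_pairwise_dual_eq_zero_one family dualForm
    (fun a b h => (dualForm_family a b).trans (if_neg h))
    (fun a => (dualForm_family a a).trans (if_pos rfl))

theorem exists_basis :
    ∃ β : Module.Basis Idx ℝ (S {2}), ∀ k, (β k : freeLie) = family k := by
  refine ⟨(Module.Basis.span linearIndependent_family).map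
    (LinearEquiv.ofEq _ _ span_range_family), fun k => ?_⟩
  simp [Module.Basis.span_apply]

end HallLayers

end

theorem mainTheorem6 :
    (∃ (B : Set HallLayers.Br) (_ : LinearOrder B),
      HallLayers.IsHallSet B ∧
      (∃ h0 : HallLayers.X 0 ∈ B, ∀ b : B, b ≤ ⟨HallLayers.X 0, h0⟩) ∧
      HallLayers.layer B {1} =
        {b | ∃ (i : Fin 3) (j : ℕ), i ≠ 0 ∧ b = HallLayers.brM i j} ∧
      HallLayers.layer B {2} =
        {b | ∃ (j l : ℕ), b = HallLayers.brC j l} ∪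
        {b | ∃ (i : Fin 3) (j l : ℕ), i ≠ 0 ∧ 1 ≤ j ∧ b = HallLayers.brW i j l}) ∧
    (∀ (i : Fin 3) (j l : ℕ), i ≠ 0 → 1 ≤ j →
      HallLayers.ev (HallLayers.brW i j l) = HallLayers.lieW i j l) ∧
    (∀ j l : ℕ, HallLayers.ev (HallLayers.brC j l) = HallLayers.lieC j l) ∧
    (∃ β : Module.Basis HallLayers.Idx ℝ (HallLayers.S {2}),
      ∀ k, (β k : HallLayers.freeLie) = HallLayers.family k) := by
  exact ⟨HallLayers.exists_hallSet, fun i j l _ _ => HallLayers.ev_brW i j l, HallLayers.ev_brC,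
    HallLayers.exists_basis⟩
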